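/- **Setting.** $N$ travelers share a single-reservoir network. Traveler $i$ has trip length $L_i>0$, desired arrival time $T_i^*$, value of time $\theta_i>0$, schedule penalties $SDE_i,SDL_i\ge 0$, and departure window $TW_i=\{t_{i,0}+k\,\Delta t:\ k=-\tau,\dots,\tau\}$, where $\tau\in\mathbb N$ and $\Delta t>0$. Departing at time $t$ costs $Toll(t)\,L_i\,w$ credits, where $Toll\ge 0$ is a given toll profile and $w>0$; every traveler receives $I$ credits per day. *Traffic.* When $n$ travelers are in the network, all of them move at speed $V(n)$. Given the departure times of all travelers, a traveler departs at her departure time and leaves the network as soon as she has covered her trip length; $n(s)$ is the number of travelers in the network at time $s$. The travel time $T_i(t)$ of traveler $i$ for departure time $t\in TW_i$ is the solution of $L_i=\int_t^{t+T_i(t)}V(n(s))\,ds$ (for a departure time that she did not choose this is the travel time of a fictional traveler who does not influence $n$). Her time cost is $tc_i(t)=T_i(t)+SDE_i\,(T_i^*-t-T_i(t))$ if $t+T_i(t)<T_i^*$, and $tc_i(t)=T_i(t)+SDL_i\,(t+T_i(t)-T_i^*)$ otherwise. *Choice.* Perceived generalized costs are recorded as (negative) money-metric utilities $C=(C_i(t))_{i,\,t\in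 TW_i}$. Given $C$, the travelers choose independently, traveler $i$ choosing $t\in TW_i$ with the logit probability $Pr_i(t)=e^{\mu C_i(t)}/\sum_{s\in TW_i}e^{\mu C_i(s)}$, where $\mu>0$. Let $\overline{tc}_i(t)[C]$ and $X(C)$ be the expected values, under these choices, of the time cost $tc_i(t)$ and of the total credit consumption $\sum_i Toll(t_i)L_iw$ (with $t_i$ the departure time chosen by $i$). The experienced generalized cost at credit price $p$ is $c_i(t)[C,p]=-\theta_i\,\overline{tc}_i(t)[C]-p\,Toll(t)L_iw$, and the excess credit consumption is $Z(C)=X(C)-I\,N$. *Dynamics.* From one day to the next, $C_i(t)\mapsto\omega C_i(t)+(1-\omega)\,c_i(t)[C,p]$ with $0<\omega<1$, and $p\mapsto p+Q(p,Z(C))$, where (1) for every $p>0$, $Q(p,\cdot)$ is strictly increasing on $\mathbb R$; (2) $Q(0,\cdot)$ is strictly increasing on $[0,\infty)$; (3) $Q(p,0)=0$ for all $p\ge0$ and $Q(0,Z)=0$ for all $Z\le0$. An equilibrium is a fixed point $(C_*,p_*)$ of these dynamics with $p_*\ge0$. *Minimal consumption.* $I_{\min}N$ is the limit, as $p\to\infty$,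 of the expected total credit consumption $\sum_i Toll(t_i)L_iw$ when the travelers choose by the logit model at utilities $-\theta_i x_i(t)-p\,Toll(t)L_iw$, the time costs $x_i(t)$ being fixed (the limit does not depend on them). **Theorem 1.** Assume that gridlock is never reached: for all choices of departure times in the windows, the speed $V(n)$ is positive at every accumulation $n$ that occurs in the course of the day (the empty network included). If $I\cdot N>I_{\min}\cdot N$, then the day-to-day tradable credit system has at least one equilibrium $(C_*,p_*)$ with $p_*\ge 0$. At it the perceived costs equal the experienced costs, $C_{i,*}(t)=c_i(t)[C_*,p_*]$ for all $i$ and $t\in TW_i$, and the credit market clears, $Q(p_*,Z_*)=0$ with $Z_*=Z(C_*)$. -/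

import Mathlib

open scoped BigOperators

noncomputable section

/-- The primitives of a day-to-day tradable credit scheme with `N` travelers who share one
reservoir network and choose among `2 * τ + 1` departure times each. -/
structure CreditScheme where
  /-- number of travelers -/
  N : ℕ
  /-- time window size parameter -/
  τ : ℕ
  /-- step size of the departure time -/
  Δt : ℝ
  Δt_pos : 0 < Δt
  /-- initial departure time of each traveler (the centre of the time window) -/
  t₀ : Fin N → ℝ
  /-- trip lengths -/
  L : Fin N → ℝ
  L_pos : ∀ i, 0 < L i
  /-- desired arrival times -/
  arrStar : Fin N → ℝ
  /-- values of time -/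
  θ : Fin N → ℝ
  θ_pos : ∀ i, 0 < θ i
  /-- schedule deviation penalty for early arrival -/
  SDE : Fin N → ℝ
  SDE_nonneg : ∀ i, 0 ≤ SDE i
  /-- schedule deviation penalty for late arrival -/
  SDL : Fin N → ℝ
  SDL_nonneg : ∀ i, 0 ≤ SDL i
  /-- average speed in the network as a function of the number of travelers in it -/
  V : ℕ → ℝ
  /-- credits charged per (scaled) unit of trip length, by departure time -/
  toll : ℝ → ℝ
  toll_nonneg : ∀ t, 0 ≤ toll t
  /-- scale factor of trip length -/
  w : ℝ
  w_pos : 0 < w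
  /-- scale parameter of the logit model -/
  μ : ℝ
  μ_pos : 0 < μ
  /-- learning parameter -/
  ω : ℝ
  ω_pos : 0 < ω
  ω_lt_one : ω < 1
  /-- daily credit endowment of every traveler -/
  I : ℝ

namespace CreditScheme

variable (M : CreditScheme)

/-- Indices of the departure times in a time window. -/
abbrev Slot : Type := Fin (2 * M.τ + 1)

/-- The departure times in the window of traveler `i`:
`t₀ i - τ Δt, t₀ i - (τ - 1) Δt, …, t₀ i + τ Δt`. -/
def depTime (i : Fin M.N) (k : M.Slot) : ℝ :=
  M.t₀ i + (((k : ℕ) : ℝ) - (M.τ : ℝ)) * M.Δt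

/-- A departure pattern: the slot actually chosen by each traveler on some day. -/
abbrev Pattern : Type := Fin M.N → M.Slot

/-! ### Trip-based traffic model: event-based simulation -/

/-- State of the simulation of one day: the clock, the remaining trip lengths, the travelers who
have not departed yet and the travelers who are in the network. -/
structure SimState where
  clock : ℝ
  remaining : Fin M.N → ℝ
  waiting : Finset (Fin M.N)
  inside : Finset (Fin M.N)

/-- Nobody has departed yet. -/
def simInit : M.SimState where
  clock := 0
  remaining := M.L
  waiting := Finset.univ
  inside := ∅

variable {M} in
/-- Current average speed. -/
def SimState.speed (S : M.SimState) : ℝ := M.V S.inside.card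

variable {M} in
/-- Arrival time of a traveler in the network, estimated at the current speed. -/
def SimState.estArrival (S : M.SimState) (i : Fin M.N) : ℝ :=
  S.clock + S.remaining i / S.speed

/-- Times of the pending events: departures of waiting travelers and estimated arrivals of the
travelers in the network. -/
def eventTimes (dep : Fin M.N → ℝ) (S : M.SimState) : Finset ℝ :=
  S.waiting.image dep ∪ S.inside.image S.estArrival

/-- Time of the next event (the current clock if there is none). -/
def nextTime (dep : Fin M.N → ℝ) (S : M.SimState) : ℝ :=
  if h : (M.eventTimes dep S).Nonempty then (M.eventTimes dep S).min' h else S.clock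

/-- Move to the time of the next event and carry out all the departures and arrivals that are due
at this time. -/
def simStep (dep : Fin M.N → ℝ) (S : M.SimState) : M.SimState where
  clock := M.nextTime dep S
  remaining := fun i =>
    if i ∈ S.inside then S.remaining i - S.speed * (M.nextTime dep S - S.clock)
    else S.remaining i
  waiting := S.waiting.filter fun i => dep i ≠ M.nextTime dep S
  inside := (S.inside.filter fun i => S.estArrival i ≠ M.nextTime dep S) ∪
    (S.waiting.filter fun i => dep i = M.nextTime dep S)

/-- State after `k` rounds, for a given departure pattern. -/
def sim (σ : M.Pattern) (k : ℕ) : M.SimState :=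
  (M.simStep fun i => M.depTime i (σ i))^[k] M.simInit

/-- Number `n(s)` of travelers in the network at time `s`: the one after the last round that took
place no later than `s`. Every round carries out at least one of the `2 N` events, so `2 N` rounds
are enough; round `0` is the empty network before the first departure. -/
def accumulation (σ : M.Pattern) (s : ℝ) : ℕ :=
  (M.sim σ (((Finset.range (2 * M.N + 1)).filter fun k => (M.sim σ k).clock ≤ s).sup id)).inside.card

/-- Gridlock is never reached: whatever departure times the travelers choose in their windows, the
speed is positive at every stage of the day. -/
def NoGridlock : Prop :=
  ∀ (σ : M.Pattern) (k : ℕ), 0 < (M.sim σ k).speed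

/-- Travel time of traveler `i` for departure slot `k` on a day with departure pattern `σ`: the
time `T` such that the distance covered from `t` to `t + T` is the trip length. For `k = σ i` this
is the experienced travel time; otherwise it is the one of a fictional traveler, who departs in
slot `k` and does not influence the accumulation. -/
def travelTime (σ : M.Pattern) (i : Fin M.N) (k : M.Slot) : ℝ :=
  sInf {T : ℝ | 0 ≤ T ∧
    ∫ s in (M.depTime i k)..(M.depTime i k + T), M.V (M.accumulation σ s) = M.L i}

theorem measurable_accumulation (σ : M.Pattern) :
    Measurable fun s => M.V (M.accumulation σ s) := by
  have hmono : Monotone fun s : ℝ =>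
      (((Finset.range (2 * M.N + 1)).filter fun k => (M.sim σ k).clock ≤ s).sup id) := by
    intro s s' h
    apply Finset.sup_mono
    intro k hk
    simp only [Finset.mem_filter] at hk ⊢
    exact ⟨hk.1, hk.2.trans h⟩
  exact (measurable_of_countable fun m : ℕ => M.V ((M.sim σ m).inside.card)).comp hmono.measurable

/-- Without gridlock the travel time is well defined: the trip length equation has exactly one
solution. -/
theorem existsUnique_travelTime (h : M.NoGridlock) (σ : M.Pattern) (i : Fin M.N) (k : M.Slot) :
    ∃! T : ℝ, 0 ≤ T ∧
      ∫ s in (M.depTime i k)..(M.depTime i k + T), M.V (M.accumulation σ s) = M.L i := by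
  set f : ℝ → ℝ := fun s => M.V (M.accumulation σ s) with hf
  set a := M.depTime i k
  have hcard : ∀ s, M.accumulation σ s ∈ Finset.range (M.N + 1) := fun s => by
    rw [Finset.mem_range, Nat.lt_succ_iff]
    exact (Finset.card_le_univ _).trans (by simp)
  have hpos : ∀ s, 0 < f s := fun s => h σ _
  obtain ⟨c, hc, hcf⟩ : ∃ c, 0 < c ∧ ∀ s, c ≤ f s := by
    obtain ⟨m, ⟨s₀, hs₀⟩, hm⟩ := Set.exists_min_image (Set.range (M.accumulation σ)) M.V
      ((Finset.range (M.N + 1)).finite_toSet.subset (by rintro _ ⟨s, rfl⟩; exact hcard s))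
      ⟨_, 0, rfl⟩
    exact ⟨M.V m, hs₀ ▸ hpos s₀, fun s => hm _ ⟨s, rfl⟩⟩
  obtain ⟨B, hB⟩ : ∃ B, ∀ s, ‖f s‖ ≤ B :=
    ⟨∑ n ∈ Finset.range (M.N + 1), ‖M.V n‖, fun s =>
      Finset.single_le_sum (f := fun n => ‖M.V n‖) (fun _ _ => norm_nonneg _) (hcard s)⟩
  have hint : ∀ x y, IntervalIntegrable f MeasureTheory.volume x y := fun x y =>
    (intervalIntegrable_const (c := B)).mono_fun
      (M.measurable_accumulation σ).aestronglyMeasurable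
      (Filter.Eventually.of_forall fun s => (hB s).trans (le_abs_self B))
  set G : ℝ → ℝ := fun T => ∫ s in a..(a + T), f s with hG
  have hGc : Continuous G :=
    (intervalIntegral.continuous_primitive hint a).comp (continuous_const.add continuous_id)
  have hGm : ∀ x y, x < y → G x + c * (y - x) ≤ G y := by
    intro x y hxy
    have h1 : G x + ∫ s in (a + x)..(a + y), f s = G y :=
      intervalIntegral.integral_add_adjacent_intervals (hint _ _) (hint _ _)
    have h2 : ∫ _ in (a + x)..(a + y), c ≤ ∫ s in (a + x)..(a + y), f s :=
      intervalIntegral.integral_mono_on (by linarith) intervalIntegrable_const (hint _ _)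
        fun s _ => hcf s
    rw [intervalIntegral.integral_const, smul_eq_mul] at h2
    nlinarith
  have hG0 : G 0 = 0 := by simp [hG]
  have hL := M.L_pos i
  have hX : (0 : ℝ) < M.L i / c := div_pos hL hc
  have hGX : M.L i ≤ G (M.L i / c) := by
    have := hGm 0 _ hX
    rw [hG0, sub_zero, mul_div_cancel₀ _ hc.ne'] at this
    linarith
  obtain ⟨T, hT, hTL⟩ := intermediate_value_Icc hX.le hGc.continuousOn
    (⟨by rw [hG0]; exact hL.le, hGX⟩ : M.L i ∈ Set.Icc (G 0) (G (M.L i / c)))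
  refine ⟨T, ⟨hT.1, hTL⟩, fun T' hT' => ?_⟩
  have hT'L : G T' = M.L i := hT'.2
  rcases lt_trichotomy T' T with hlt | heq | hlt
  · have := hGm _ _ hlt
    nlinarith
  · exact heq
  · have := hGm _ _ hlt
    nlinarith

/-- Time related part of the cost: travel time and schedule deviation penalty. -/
def timeCost (σ : M.Pattern) (i : Fin M.N) (k : M.Slot) : ℝ :=
  let t := M.depTime i k
  let T := M.travelTime σ i k
  if t + T < M.arrStar i then T + M.SDE i * (M.arrStar i - t - T)
  else T + M.SDL i * (t + T - M.arrStar i)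

/-! ### Departure time choice, learning and price evolution -/

/-- A value for every traveler and every departure slot. Perceived and experienced generalized
costs are recorded as (negative) money metric utilities. -/
abbrev Profile : Type := Fin M.N → M.Slot → ℝ

/-- Logit probability that traveler `i` departs in slot `k` under perceived values `C`. -/
def choiceProb (C : M.Profile) (i : Fin M.N) (k : M.Slot) : ℝ :=
  Real.exp (M.μ * C i k) / ∑ s, Real.exp (M.μ * C i s)

/-- Probability of a departure pattern; the travelers choose independently. -/
def patternProb (C : M.Profile) (σ : M.Pattern) : ℝ :=
  ∏ i, M.choiceProb C i (σ i)

/-- Mean time cost over the departure patterns induced by the perceived values `C`. -/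
def meanTimeCost (C : M.Profile) (i : Fin M.N) (k : M.Slot) : ℝ :=
  ∑ σ : M.Pattern, M.patternProb C σ * M.timeCost σ i k

/-- Credits paid by traveler `i` for departing in slot `k`. -/
def charge (i : Fin M.N) (k : M.Slot) : ℝ :=
  M.toll (M.depTime i k) * M.L i * M.w

/-- Money metric value of given time costs `x` and of the credit payments at price `p`. -/
def genValue (x : M.Profile) (p : ℝ) : M.Profile :=
  fun i k => -(M.θ i * x i k) - p * M.charge i k

/-- Experienced generalized value at price `p` when the perceived values are `C`. -/
def experienced (C : M.Profile) (p : ℝ) : M.Profile :=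
  M.genValue (M.meanTimeCost C) p

/-- Mean total credit consumption over the departure patterns induced by `C`. -/
def consumption (C : M.Profile) : ℝ :=
  ∑ σ : M.Pattern, M.patternProb C σ * ∑ i, M.charge i (σ i)

/-- Excess credit consumption. -/
def excess (C : M.Profile) : ℝ :=
  M.consumption C - M.I * (M.N : ℝ)

/-- Conditions on the function `Q p Z` that gives the daily change of the credit price. -/
structure IsPriceRule (Q : ℝ → ℝ → ℝ) : Prop where
  strictMono_of_pos : ∀ p, 0 < p → StrictMono (Q p)
  strictMonoOn_zero : StrictMonoOn (Q 0) (Set.Ici 0)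
  apply_zero : ∀ p, 0 ≤ p → Q p 0 = 0
  zero_apply : ∀ Z, Z ≤ 0 → Q 0 Z = 0

/-- One day of the dynamics: the perceived values are updated with the experienced ones, and the
price with the excess consumption. -/
def dayStep (Q : ℝ → ℝ → ℝ) (X : M.Profile × ℝ) : M.Profile × ℝ :=
  (fun i k => M.ω * X.1 i k + (1 - M.ω) * M.experienced X.1 X.2 i k,
    X.2 + Q X.2 (M.excess X.1))

/-- An equilibrium: a nonnegative price and perceived values that the dynamics do not change. -/
def IsEquilibrium (Q : ℝ → ℝ → ℝ) (C : M.Profile) (p : ℝ) : Prop :=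
  0 ≤ p ∧ Function.IsFixedPt (M.dayStep Q) (C, p)

end CreditScheme

end

/-! An equilibrium is obtained from complementarity: values that equal the experienced ones, excess
consumption at most zero, and zero excess if the price is positive. The conditions on `Q` at zero
excess and at zero price then make the price stationary (`theorem1`).

Such a pair comes from Brouwer's theorem, applied to mean time costs and a price in `[0, P]`
(`exists_fixedPoint_truncated`). The price moves to `p + Z`, truncated, rather than to `p + Q p Z`,
because `Q` is not assumed continuous. The map is continuous since there are finitely many departure
patterns, each with constant time costs, weighted by continuous logit probabilities; the same
finiteness bounds the time costs. At a high price logit choices concentrate on the cheapest slots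
(`consumption_genValue_le`), so for large `P` consumption at `P` is below the endowment and the
fixed point has `p < P`. The upper truncation is then inactive, and the lower one gives
complementarity (`exists_market_clearing`).

Brouwer's theorem is derived from Scarf's lemma (`exists_colorful_room`), a parity argument on doors
and rooms, applied to finer and finer grids in the simplex. -/

/-! ### Scarf's combinatorial lemma -/

section Scarf

variable {T I : Type*} (u : I → T → ℕ)

/-- A set `σ` of points is dominant with respect to a set `C` of orders if no point lies strictly
above the minimum of `σ` in all the orders of `C`. -/
def IsDominant (σ : Finset T) (C : Finset I) : Prop :=
  ∀ x, ∃ i ∈ C, ∀ y ∈ σ, u i x ≤ u i y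

variable {u}

theorem IsDominant.mono {σ τ : Finset T} {C D : Finset I} (h : IsDominant u σ C) (hτ : τ ⊆ σ)
    (hD : C ⊆ D) : IsDominant u τ D := fun x => by
  obtain ⟨i, hi, hx⟩ := h x
  exact ⟨i, hD hi, fun y hy => hx y (hτ hy)⟩

variable [DecidableEq T] [DecidableEq I]

theorem exists_erase_of_card {α : Type*} [DecidableEq α] {s t : Finset α} (h : s ⊆ t)
    (hc : t.card = s.card + 1) : ∃ a ∈ t, a ∉ s ∧ s = t.erase a ∧ t = insert a s := by
  have h1 : (t \ s).card = 1 := by rw [Finset.card_sdiff_of_subset h]; omega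
  obtain ⟨a, ha⟩ := Finset.card_eq_one.1 h1
  have hat : a ∈ t \ s := by simp [ha]
  rw [Finset.mem_sdiff] at hat
  have key : ∀ x, x ∈ t ∧ x ∉ s ↔ x = a := fun x => by
    rw [← Finset.mem_sdiff, ha, Finset.mem_singleton]
  refine ⟨a, hat.1, hat.2, ?_, ?_⟩
  · ext x
    have := key x
    have := @h x
    rw [Finset.mem_erase]
    tauto
  · ext x
    have := key x
    have := @h x
    rw [Finset.mem_insert]
    tauto

/-- The two ways to extend a door `(τ, D)` with minimum function `m` to a room, by giving up the
order `j` or by adding a point that is the new minimum for `j` only. -/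
def IsRoomOver (u : I → T → ℕ) (τ : Finset T) (D : Finset I) (m : I → T) (j : I)
    (r : Finset T × Finset I) : Prop :=
  IsDominant u r.1 r.2 ∧ (r = (τ, D.erase j) ∨
    ∃ x ∉ τ, r = (insert x τ, D) ∧ ∀ i ∈ D, i ≠ j → u i (m i) < u i x)

/-- Consider the points above the minima of `τ` in all orders of `D` except `j`. If there are none,
`j` can be dropped. Otherwise `j` is needed, and dominance allows only the point among them that is
highest in order `j`. -/
theorem existsUnique_isRoomOver [Finite T] {τ : Finset T} {D : Finset I} {m : I → T} {j j' : I}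
    (hu : ∀ i, Function.Injective (u i))
    (hdom : IsDominant u τ D) (hm : ∀ i, m i ∈ τ) (hmin : ∀ i, ∀ y ∈ τ, u i (m i) ≤ u i y)
    (hj' : j' ∈ D) (hne : j' ≠ j) (heq : m j = m j')
    (hsurj : ∀ x ∈ τ, ∃ i ∈ D, i ≠ j ∧ m i = x) :
    ∃! r, IsRoomOver u τ D m j r := by
  by_cases hX : ∃ x, ∀ i ∈ D, i ≠ j → u i (m i) < u i x
  · obtain ⟨x, hx, hxmax⟩ := Set.exists_max_image {x | ∀ i ∈ D, i ≠ j → u i (m i) < u i x} (u j)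
      (Set.toFinite _) hX
    -- Only order `j` can witness dominance at `x`. Equality would give `x = m j = m j'`, but `x` is
    -- strictly above `m j'` in order `j'`.
    have hxj : u j x < u j (m j) := by
      obtain ⟨i, hi, hxi⟩ := hdom x
      by_cases hij : i = j
      · subst hij
        refine lt_of_le_of_ne (hxi _ (hm i)) fun h => ?_
        have h1 := hx j' hj' hne
        rw [hu i h, heq] at h1
        exact lt_irrefl _ h1
      · exact absurd (hxi _ (hm i)) (not_le.2 (hx i hi hij))
    have hxτ : ∀ z, (∀ i ∈ D, i ≠ j → u i (m i) < u i z) → z ∉ τ := fun z hz hzτ => by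
      obtain ⟨i, hi, hij, rfl⟩ := hsurj z hzτ
      exact lt_irrefl _ (hz i hi hij)
    refine ⟨(insert x τ, D), ⟨?_, Or.inr ⟨x, hxτ x hx, rfl, hx⟩⟩, ?_⟩
    · intro y
      by_cases hy : ∀ i ∈ D, i ≠ j → u i (m i) < u i y
      · obtain ⟨i, hi, hyi⟩ := hdom y
        have hij : i = j := by
          by_contra hij
          exact absurd (hyi _ (hm i)) (not_le.2 (hy i hi hij))
        subst hij
        refine ⟨i, hi, fun z hz => ?_⟩
        rcases Finset.mem_insert.1 hz with rfl | hz
        · exact hxmax y hy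
        · exact hyi z hz
      · push Not at hy
        obtain ⟨i, hi, hij, hyi⟩ := hy
        refine ⟨i, hi, fun z hz => ?_⟩
        rcases Finset.mem_insert.1 hz with rfl | hz
        · exact hyi.trans (hx i hi hij).le
        · exact hyi.trans (hmin i z hz)
    · rintro r ⟨hr, rfl | ⟨x', hx', rfl, hx'u⟩⟩
      · obtain ⟨i, hi, hxi⟩ := hr x
        have hi := Finset.mem_erase.1 hi
        exact absurd (hxi _ (hm i)) (not_le.2 (hx i hi.2 hi.1))
      · obtain ⟨i, hi, hxi⟩ := hr x
        have hij : i = j := by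
          by_contra hij
          exact absurd (hxi _ (Finset.mem_insert_of_mem (hm i))) (not_le.2 (hx i hi hij))
        subst hij
        have := hu i (le_antisymm (hxi x' (Finset.mem_insert_self _ _)) (hxmax x' hx'u))
        rw [this]
  · refine ⟨(τ, D.erase j), ⟨?_, Or.inl rfl⟩, ?_⟩
    · intro x
      push Not at hX
      obtain ⟨i, hi, hij, h⟩ := hX x
      exact ⟨i, Finset.mem_erase.2 ⟨hij, hi⟩, fun y hy => h.trans (hmin i y hy)⟩
    · rintro r ⟨-, rfl | ⟨x', -, rfl, hx'u⟩⟩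
      · rfl
      · exact absurd ⟨x', hx'u⟩ hX

/-- A room is a dominant pair of equal cardinalities. -/
def IsRoom (u : I → T → ℕ) (r : Finset T × Finset I) : Prop :=
  IsDominant u r.1 r.2 ∧ r.1.card = r.2.card

/-- Dominance makes every point of `τ` the minimum for some order of `D`, so `m` maps `D` onto a set
with one element less and has exactly one collision `a`, `b`. The order freed in passing to a room
must be one of these two, and each yields one room. -/
theorem exists_pair_rooms_of_door [Finite T] (hu : ∀ i, Function.Injective (u i))
    {τ : Finset T} {D : Finset I} (hdom : IsDominant u τ D) (hne : τ.Nonempty)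
    (hcard : D.card = τ.card + 1) :
    ∃ r r', r ≠ r' ∧ ∀ q : Finset T × Finset I,
      (IsRoom u q ∧ τ ⊆ q.1 ∧ q.2 ⊆ D) ↔ (q = r ∨ q = r') := by
  choose m hm hmin using fun i => Finset.exists_min_image τ (u i) hne
  obtain ⟨a, ha, b, hb, hab, hmab⟩ := Finset.exists_ne_map_eq_of_card_lt_of_maps_to
    (s := D) (t := τ) (f := m) (by omega) (fun i _ => hm i)
  have hsurjD : ∀ x ∈ τ, ∃ i ∈ D, m i = x := fun x hx => by
    obtain ⟨i, hi, hxi⟩ := hdom x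
    exact ⟨i, hi, hu i (le_antisymm (hmin i x hx) (hxi _ (hm i)))⟩
  have hsa : ∀ x ∈ τ, ∃ i ∈ D, i ≠ a ∧ m i = x := fun x hx => by
    obtain ⟨i, hi, rfl⟩ := hsurjD x hx
    by_cases h : i = a
    · exact ⟨b, hb, hab.symm, by rw [h, hmab]⟩
    · exact ⟨i, hi, h, rfl⟩
  have hsb : ∀ x ∈ τ, ∃ i ∈ D, i ≠ b ∧ m i = x := fun x hx => by
    obtain ⟨i, hi, rfl⟩ := hsurjD x hx
    by_cases h : i = b
    · exact ⟨a, ha, hab, by rw [h, hmab]⟩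
    · exact ⟨i, hi, h, rfl⟩
  have honly : ∀ j ∈ D, (∀ x ∈ τ, ∃ i ∈ D, i ≠ j ∧ m i = x) → j = a ∨ j = b := by
    intro j hj hs
    by_contra! hj'
    have himg : (D.erase j).image m = τ := by
      ext x
      simp only [Finset.mem_image, Finset.mem_erase]
      constructor
      · rintro ⟨i, -, rfl⟩
        exact hm i
      · intro hx
        obtain ⟨i, hi, hij, h⟩ := hs x hx
        exact ⟨i, ⟨hij, hi⟩, h⟩
    have hinj : Set.InjOn m (D.erase j) := Finset.card_image_iff.1 (by
      rw [himg, Finset.card_erase_of_mem hj]; omega)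
    exact hab (hinj (by simp [ha, hj'.1.symm]) (by simp [hb, hj'.2.symm]) hmab)
  obtain ⟨r, hr, hru⟩ := existsUnique_isRoomOver hu hdom hm hmin hb hab.symm hmab hsa
  obtain ⟨r', hr', hru'⟩ := existsUnique_isRoomOver hu hdom hm hmin ha hab hmab.symm hsb
  have hroom : ∀ j ∈ D, ∀ q, IsRoomOver u τ D m j q → IsRoom u q ∧ τ ⊆ q.1 ∧ q.2 ⊆ D := by
    rintro j hj q ⟨hq, rfl | ⟨x, hx, rfl, -⟩⟩
    · exact ⟨⟨hq, by rw [Finset.card_erase_of_mem hj]; simp [hcard]⟩, Finset.Subset.refl _,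
        Finset.erase_subset _ _⟩
    · exact ⟨⟨hq, by simp [Finset.card_insert_of_notMem hx, hcard]⟩, Finset.subset_insert _ _,
        Finset.Subset.refl _⟩
  refine ⟨r, r', ?_, fun q => ⟨?_, ?_⟩⟩
  · rintro rfl
    rcases hr with ⟨-, rfl | ⟨x, hx, rfl, hxa⟩⟩ <;> rcases hr' with ⟨-, h | ⟨y, hy, h, hyb⟩⟩
    · have : a ∈ D.erase a := by
        rw [(Prod.mk.inj h).2]; exact Finset.mem_erase.2 ⟨hab, ha⟩
      simp at this
    · refine hy ?_
      rw [(Prod.mk.inj h).1]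
      exact Finset.mem_insert_self y τ
    · refine hx ?_
      rw [← (Prod.mk.inj h).1]
      exact Finset.mem_insert_self x τ
    · have hxy : x = y := by
        have h1 : x ∈ insert y τ := by
          rw [← (Prod.mk.inj h).1]
          exact Finset.mem_insert_self x τ
        rcases Finset.mem_insert.1 h1 with h1 | h1
        · exact h1
        · exact absurd h1 hx
      subst hxy
      obtain ⟨i, hi, hxi⟩ := hdom x
      by_cases hia : i = a
      · exact absurd (hxi _ (hm i)) (not_le.2 (hyb i hi (hia ▸ hab)))
      · exact absurd (hxi _ (hm i)) (not_le.2 (hxa i hi hia))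
  · rintro ⟨⟨hq, hqc⟩, hτ, hD⟩
    suffices h : ∃ j ∈ D, (∀ x ∈ τ, ∃ i ∈ D, i ≠ j ∧ m i = x) ∧ IsRoomOver u τ D m j q by
      obtain ⟨j, hj, hs, hq⟩ := h
      rcases honly j hj hs with rfl | rfl
      · exact Or.inl (hru q hq)
      · exact Or.inr (hru' q hq)
    obtain ⟨σ, C⟩ := q
    simp only at hq hqc hτ hD
    by_cases hστ : σ = τ
    · subst hστ
      obtain ⟨j, hj, -, hC, -⟩ := exists_erase_of_card hD (by omega)
      refine ⟨j, hj, fun x hx => ?_, hq, Or.inl (by rw [hC])⟩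
      obtain ⟨i, hi, hxi⟩ := hq x
      rw [hC, Finset.mem_erase] at hi
      exact ⟨i, hi.2, hi.1, hu i (le_antisymm (hmin i x hx) (hxi _ (hm i)))⟩
    · have h1 : τ.card < σ.card := Finset.card_lt_card (Finset.ssubset_iff_subset_ne.2
        ⟨hτ, fun h => hστ h.symm⟩)
      have h2 := Finset.card_le_card hD
      have hCD : C = D := Finset.eq_of_subset_of_card_le hD (by omega)
      subst hCD
      obtain ⟨x, hxσ, hxτ, -, rfl⟩ := exists_erase_of_card hτ (by omega)
      -- `g` picks for each point of the room an order in which it is the minimum. It is injective,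
      -- hence onto `C` by counting; the freed order is that of the new point `x`.
      choose g hg hgmin using hq
      have hginj : Set.InjOn g (insert x τ : Finset T) := fun y hy z hz hyz =>
        hu (g y) (le_antisymm (hgmin y z hz) (by rw [hyz]; exact hgmin z y hy))
      have himg : (insert x τ).image g = C := Finset.eq_of_subset_of_card_le
        (fun i hi => by
          obtain ⟨y, -, rfl⟩ := Finset.mem_image.1 hi
          exact hg y) (by rw [Finset.card_image_of_injOn hginj]; omega)
      refine ⟨g x, hg x, fun y hy => ⟨g y, hg y, fun h => ?_, ?_⟩,
        fun y => ⟨g y, hg y, hgmin y⟩, Or.inr ⟨x, hxτ, rfl, fun i hi hix => ?_⟩⟩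
      · exact hxτ (hginj (Finset.mem_insert_of_mem hy) (Finset.mem_insert_self _ _) h ▸ hy)
      · exact hu _ (le_antisymm (hmin _ y hy) (hgmin y _ (Finset.mem_insert_of_mem (hm _))))
      · rw [← himg, Finset.mem_image] at hi
        obtain ⟨y, hy, rfl⟩ := hi
        rcases Finset.mem_insert.1 hy with rfl | hy
        · exact absurd rfl hix
        · refine lt_of_le_of_ne ((hmin _ y hy).trans (hgmin y x (Finset.mem_insert_self _ _)))
            fun h => ?_
          exact hxτ (hu _ h ▸ hm _)
  · rintro (rfl | rfl)
    · exact hroom a ha _ hr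
    · exact hroom b hb _ hr'

/-! ### Colored doors and the parity count. -/

variable (c : T → I) (i₀ : I)

/-- A door whose points carry exactly the colors other than `i₀`. -/
def IsTypedDoor (u : I → T → ℕ) (d : Finset T × Finset I) : Prop :=
  IsDominant u d.1 d.2 ∧ d.2.card = d.1.card + 1 ∧ i₀ ∈ d.2 ∧ d.1.image c = d.2.erase i₀

/-- A typed door arises from the room by adding an order or deleting a point. If the points carry a
color `j` outside `C`, the coloring is injective and the two doors add the order `j` or delete the
point of color `j`. Otherwise the colors are `C.erase i₀`, exactly two points share a color, and the
doors delete one or the other. -/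
theorem even_doors_of_room {r : Finset T × Finset I} (hr : IsRoom u r)
    (hc : r.1.image c ≠ r.2) {d : Finset T × Finset I} (hd : IsTypedDoor c i₀ u d)
    (hd1 : d.1 ⊆ r.1) (hd2 : r.2 ⊆ d.2) :
    ∃ e e', e ≠ e' ∧ ∀ q : Finset T × Finset I,
      (IsTypedDoor c i₀ u q ∧ q.1 ⊆ r.1 ∧ r.2 ⊆ q.2) ↔ (q = e ∨ q = e') := by
  obtain ⟨hrd, hrc⟩ := hr
  obtain ⟨σ, C⟩ := r
  simp only at *
  have hshape : ∀ q : Finset T × Finset I, IsTypedDoor c i₀ u q → q.1 ⊆ σ → C ⊆ q.2 →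
      i₀ ∈ C ∧ ((∃ j, j ∉ C ∧ q = (σ, insert j C) ∧ σ.image c = insert j (C.erase i₀)) ∨
      ∃ x ∈ σ, q = (σ.erase x, C) ∧ (σ.erase x).image c = C.erase i₀ ∧ c x ≠ i₀ ∧
        σ.image c = insert (c x) (C.erase i₀)) := by
    rintro ⟨τ, D⟩ ⟨-, hcard, hi, himg⟩ h1 h2
    simp only at *
    by_cases hτ : τ = σ
    · subst hτ
      obtain ⟨j, -, hjC, -, rfl⟩ := exists_erase_of_card h2 (by omega)
      have hji : i₀ ≠ j := by
        rintro rfl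
        exact hc (by rw [himg, Finset.erase_insert hjC])
      refine ⟨(Finset.mem_insert.1 hi).resolve_left hji, Or.inl ⟨j, hjC, rfl, ?_⟩⟩
      rw [himg, Finset.erase_insert_of_ne hji.symm]
    · have h3 : τ.card < σ.card := Finset.card_lt_card (Finset.ssubset_iff_subset_ne.2 ⟨h1, hτ⟩)
      have h4 := Finset.card_le_card h2
      obtain rfl : C = D := Finset.eq_of_subset_of_card_le h2 (by omega)
      obtain ⟨x, hx, hxτ, rfl, -⟩ := exists_erase_of_card h1 (by omega)
      have hσ : σ.image c = insert (c x) (C.erase i₀) := by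
        rw [← himg, ← Finset.image_insert, Finset.insert_erase hx]
      refine ⟨hi, Or.inr ⟨x, hx, rfl, himg, fun h => hc ?_, hσ⟩⟩
      rw [hσ, h, Finset.insert_erase hi]
  have hdoor : ∀ x ∈ σ, i₀ ∈ C → (σ.erase x).image c = C.erase i₀ →
      IsTypedDoor c i₀ u (σ.erase x, C) ∧ σ.erase x ⊆ σ ∧ C ⊆ C := fun x hx hi h =>
    ⟨⟨hrd.mono (Finset.erase_subset _ _) (Finset.Subset.refl _),
      by have := Finset.card_pos.2 ⟨x, hx⟩
         simp only [Finset.card_erase_of_mem hx]; omega, hi, h⟩,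
      Finset.erase_subset _ _, Finset.Subset.refl _⟩
  obtain ⟨hi, hcase⟩ := hshape d hd hd1 hd2
  have hC := Finset.card_erase_of_mem hi
  have hCpos := Finset.card_pos.2 ⟨i₀, hi⟩
  have herase_ne : ∀ x ∈ σ, ∀ y ∈ σ, σ.erase x = σ.erase y → x = y := fun x hx y hy h => by
    by_contra hxy
    have : x ∈ σ.erase x := by rw [h]; exact Finset.mem_erase.2 ⟨hxy, hx⟩
    simp at this
  by_cases hj : ∃ j, j ∉ C ∧ σ.image c = insert j (C.erase i₀)
  · obtain ⟨j, hjC, himg⟩ := hj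
    have hjC' : j ∉ C.erase i₀ := fun h => hjC (Finset.mem_of_mem_erase h)
    have hinj : Set.InjOn c σ := Finset.card_image_iff.1 (by
      rw [himg, Finset.card_insert_of_notMem hjC', hC]; omega)
    obtain ⟨x, hx, hxj⟩ := Finset.mem_image.1 (himg ▸ Finset.mem_insert_self j _ : j ∈ σ.image c)
    have hj_uniq : ∀ k, k ∉ C → σ.image c = insert k (C.erase i₀) → k = j := fun k hk h => by
      have : k ∈ insert j (C.erase i₀) := by rw [← himg, h]; exact Finset.mem_insert_self _ _
      rcases Finset.mem_insert.1 this with h | h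
      · exact h
      · exact absurd (Finset.mem_of_mem_erase h) hk
    refine ⟨(σ, insert j C), (σ.erase x, C), fun h => ?_, fun q => ⟨?_, ?_⟩⟩
    · have : j ∈ C := by
        rw [← (Prod.mk.inj h).2]
        exact Finset.mem_insert_self j C
      exact hjC this
    · rintro ⟨hq, hq1, hq2⟩
      rcases (hshape q hq hq1 hq2).2 with ⟨k, hk, rfl, hk'⟩ | ⟨y, hy, rfl, -, -, h⟩
      · left; rw [hj_uniq k hk hk']
      · right
        have : j ∈ insert (c y) (C.erase i₀) := by
          rw [← h, himg]; exact Finset.mem_insert_self _ _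
        have hjy := (Finset.mem_insert.1 this).resolve_right hjC'
        rw [hinj hx hy (hxj.trans hjy)]
    · rintro (rfl | rfl)
      · refine ⟨⟨hrd.mono (Finset.Subset.refl _) (Finset.subset_insert _ _), ?_,
          Finset.mem_insert_of_mem hi, ?_⟩, Finset.Subset.refl _, Finset.subset_insert _ _⟩
        · simp [Finset.card_insert_of_notMem hjC, hrc]
        · simp only
          rw [himg, Finset.erase_insert_of_ne]
          rintro rfl
          exact hjC hi
      · refine hdoor x hx hi ?_
        ext k
        have hk : k ∈ σ.image c ↔ k ∈ insert j (C.erase i₀) := by rw [himg]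
        simp only [Finset.mem_image, Finset.mem_insert] at hk ⊢
        constructor
        · rintro ⟨y, hy, rfl⟩
          have hy := Finset.mem_erase.1 hy
          rcases hk.1 ⟨y, hy.2, rfl⟩ with h | h
          · exact absurd (hinj hy.2 hx (h.trans hxj.symm)) hy.1
          · exact h
        · intro h
          obtain ⟨y, hy, rfl⟩ := hk.2 (Or.inr h)
          refine ⟨y, Finset.mem_erase.2 ⟨?_, hy⟩, rfl⟩
          rintro rfl
          exact hjC' (hxj ▸ h)
  · have himg : σ.image c = C.erase i₀ := by
      rcases hcase with ⟨j, h1, -, h2⟩ | ⟨x, hx, -, -, h1, h2⟩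
      · exact absurd ⟨j, h1, h2⟩ hj
      · rw [h2]
        refine Finset.insert_eq_self.2 (Finset.mem_erase.2 ⟨h1, ?_⟩)
        by_contra h
        exact hj ⟨c x, h, h2⟩
    obtain ⟨x, hx, y, hy, hxy, hcxy⟩ := Finset.exists_ne_map_eq_of_card_lt_of_maps_to
      (s := σ) (t := C.erase i₀) (f := c) (by omega)
      (fun z hz => himg ▸ Finset.mem_image_of_mem c hz)
    have himg' : ∀ x ∈ σ, ∀ y ∈ σ, x ≠ y → c x = c y → (σ.erase x).image c = C.erase i₀ := by
      intro x hx y hy hxy hcxy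
      rw [← himg]
      refine Finset.Subset.antisymm (Finset.image_subset_image (Finset.erase_subset _ _)) ?_
      intro k hk
      obtain ⟨z, hz, rfl⟩ := Finset.mem_image.1 hk
      by_cases hzx : z = x
      · rw [hzx, hcxy]
        exact Finset.mem_image_of_mem c (Finset.mem_erase.2 ⟨hxy.symm, hy⟩)
      · exact Finset.mem_image_of_mem c (Finset.mem_erase.2 ⟨hzx, hz⟩)
    refine ⟨(σ.erase x, C), (σ.erase y, C), fun h => hxy (herase_ne x hx y hy
      (Prod.ext_iff.1 h).1), fun q => ⟨?_, ?_⟩⟩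
    · rintro ⟨hq, hq1, hq2⟩
      rcases (hshape q hq hq1 hq2).2 with ⟨k, hk, -, hk'⟩ | ⟨z, hz, rfl, hz', -⟩
      · exact absurd ⟨k, hk, hk'⟩ hj
      · have hinj : Set.InjOn c (σ.erase z) := Finset.card_image_iff.1 (by
          rw [hz', hC, Finset.card_erase_of_mem hz]; omega)
        by_contra! hne
        have hzx : x ≠ z := fun h => hne.1 (by rw [h])
        have hzy : y ≠ z := fun h => hne.2 (by rw [h])
        exact hxy (hinj (by simp [hzx, hx]) (by simp [hzy, hy]) hcxy)
    · rintro (rfl | rfl)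
      · exact hdoor x hx hi (himg' x hx y hy hxy hcxy)
      · exact hdoor y hy hi (himg' y hy x hx hxy.symm hcxy.symm)

/-- **Scarf's lemma**: every coloring admits a dominant pair whose points carry exactly the colors
of the orders in the pair. -/
theorem exists_colorful_room [Fintype T] [Nonempty T] [Fintype I] [Nonempty I]
    (hu : ∀ i, Function.Injective (u i)) :
    ∃ (σ : Finset T) (C : Finset I), IsDominant u σ C ∧ σ.card = C.card ∧ σ.image c = C := by
  classical
  by_contra! hno
  obtain ⟨i₀⟩ := ‹Nonempty I›
  let rooms : Finset (Finset T × Finset I) := Finset.univ.filter (IsRoom u)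
  let doors : Finset (Finset T × Finset I) := Finset.univ.filter (IsTypedDoor c i₀ u)
  let rel : Finset T × Finset I → Finset T × Finset I → Prop := fun d r => d.1 ⊆ r.1 ∧ r.2 ⊆ d.2
  -- Incidences of typed doors and rooms are counted twice. Without a colorful room, every room has
  -- 0 or 2 typed doors; every typed door has 2 rooms, except `(∅, {i₀})`, which has one.
  have hcount := Finset.sum_card_bipartiteAbove_eq_sum_card_bipartiteBelow (s := doors)
    (t := rooms) rel
  have hpair : ∀ (s : Finset (Finset T × Finset I)) e e', e ≠ e' →
      (∀ q, q ∈ s ↔ q = e ∨ q = e') → s.card = 2 := fun s e e' hne h => by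
    rw [Finset.card_eq_two]
    exact ⟨e, e', hne, by ext q; simp [h]⟩
  have heven : Even (∑ r ∈ rooms, (doors.bipartiteBelow rel r).card) := by
    refine Finset.even_sum _ fun r hr => ?_
    have hr : IsRoom u r := (Finset.mem_filter.1 hr).2
    rcases (doors.bipartiteBelow rel r).eq_empty_or_nonempty with h | ⟨d, hd⟩
    · simp [h]
    · simp only [Finset.bipartiteBelow, Finset.mem_filter, doors, rel, Finset.mem_univ,
        true_and] at hd
      obtain ⟨e, e', hne, h⟩ := even_doors_of_room c i₀ hr (hno r.1 r.2 hr.1 hr.2) hd.1 hd.2.1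
        hd.2.2
      rw [hpair _ e e' hne fun q => ?_]
      · exact even_two
      · rw [← h q]
        simp [Finset.bipartiteBelow, doors, rel]
  obtain ⟨t, -, ht⟩ := Finset.exists_max_image (Finset.univ : Finset T) (u i₀)
    Finset.univ_nonempty
  have hmem : ((∅, {i₀}) : Finset T × Finset I) ∈ doors := by
    simp only [doors, Finset.mem_filter, Finset.mem_univ, true_and]
    exact ⟨fun x => ⟨i₀, by simp, by simp⟩, by simp, by simp, by simp⟩
  have hone : (rooms.bipartiteAbove rel (∅, {i₀})).card = 1 := by
    rw [Finset.card_eq_one]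
    refine ⟨({t}, {i₀}), ?_⟩
    ext ⟨σ, C⟩
    simp only [Finset.bipartiteAbove, rooms, rel, Finset.mem_filter, Finset.mem_univ, true_and,
      Finset.empty_subset, Finset.mem_singleton, IsRoom, Finset.subset_singleton_iff,
      Prod.mk.injEq]
    constructor
    · rintro ⟨⟨hd, hcard⟩, rfl | rfl⟩
      · obtain ⟨i, hi, -⟩ := hd t
        simp at hi
      · rw [Finset.card_singleton, Finset.card_eq_one] at hcard
        obtain ⟨x, rfl⟩ := hcard
        obtain ⟨i, hi, h⟩ := hd t
        obtain rfl := Finset.mem_singleton.1 hi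
        rw [hu i (le_antisymm (h x (by simp)) (ht x (Finset.mem_univ x)))]
        simp
    · rintro ⟨rfl, rfl⟩
      exact ⟨⟨fun x => ⟨i₀, by simp, by simpa using ht x (Finset.mem_univ x)⟩, by simp⟩,
        Or.inr rfl⟩
  have hodd : Odd (∑ d ∈ doors, (rooms.bipartiteAbove rel d).card) := by
    rw [← Finset.add_sum_erase _ _ hmem, hone]
    refine Odd.add_even odd_one (Finset.even_sum _ fun d hd => ?_)
    obtain ⟨hne, hd⟩ := Finset.mem_erase.1 hd
    obtain ⟨hdom, hcard, hi, himg⟩ := (Finset.mem_filter.1 hd).2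
    have hτ : d.1.Nonempty := by
      rw [Finset.nonempty_iff_ne_empty]
      intro h0
      refine hne (Prod.ext h0 ?_)
      rw [h0, Finset.card_empty, zero_add, Finset.card_eq_one] at hcard
      obtain ⟨k, hk⟩ := hcard
      rw [hk, Finset.mem_singleton] at hi
      simp [hk, hi]
    obtain ⟨e, e', hee, h⟩ := exists_pair_rooms_of_door hu hdom hτ hcard
    rw [hpair _ e e' hee fun q => ?_]
    · exact even_two
    · rw [← h q]
      simp [Finset.bipartiteAbove, rooms, rel]
  rw [hcount] at hodd
  exact (Nat.not_even_iff_odd.2 hodd) heven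

end Scarf

/-! ### Brouwer's fixed point theorem on simplices and boxes -/

section Brouwer

open Filter Topology

variable {ι : Type*} [Fintype ι] [DecidableEq ι]

/-- Scarf's lemma for the points with natural coordinates of sum `m`: a color `i` is attained near
`z` unless the coordinate `i` of `z` is small. -/
theorem exists_grid_point [Nonempty ι] (m : ℕ) (c : (ι → ℕ) → ι) :
    ∃ z : ι → ℕ, ∑ i, z i = m ∧ ∀ i, z i ≤ Fintype.card ι ∨ ∃ y : ι → ℕ, ∑ j, y j = m ∧
      (∀ j, y j ≤ z j + Fintype.card ι ∧ z j ≤ y j + Fintype.card ι) ∧ c y = i := by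
  classical
  let T := {x // x ∈ Finset.piAntidiag (Finset.univ : Finset ι) m}
  have hT : ∀ x : T, ∑ i, x.1 i = m := fun x => (Finset.mem_piAntidiag.1 x.2).1
  have hmk : ∀ x : ι → ℕ, ∑ i, x i = m → x ∈ Finset.piAntidiag (Finset.univ : Finset ι) m :=
    fun x hx => Finset.mem_piAntidiag.2 ⟨hx, by simp⟩
  obtain ⟨k₀⟩ := ‹Nonempty ι›
  have : Nonempty T := ⟨⟨Pi.single k₀ m, hmk _ (by simp)⟩⟩
  let e := Fintype.equivFin T
  let n := Fintype.card T
  -- Order `i` compares the coordinates `i`; the enumeration `e`, with values below `n`, breaks ties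
  -- to make it injective.
  let u : ι → T → ℕ := fun i x => x.1 i * n + e x
  have hule : ∀ i x y, u i x ≤ u i y → x.1 i ≤ y.1 i := fun i x y h => by
    by_contra! hlt
    have h1 : (y.1 i + 1) * n ≤ x.1 i * n := Nat.mul_le_mul_right _ hlt
    have h2 : (e y : ℕ) < n := (e y).2
    have h3 : x.1 i * n + e x ≤ y.1 i * n + e y := h
    rw [add_mul] at h1
    omega
  have hu : ∀ i, Function.Injective (u i) := fun i x y h => by
    have h1 := le_antisymm (hule i x y h.le) (hule i y x h.ge)
    have h2 : x.1 i * n + e x = y.1 i * n + e y := h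
    rw [h1] at h2
    exact e.injective (Fin.ext (by omega))
  have : Nonempty ι := ⟨k₀⟩
  obtain ⟨σ, C, hdom, hcard, himg⟩ := exists_colorful_room (u := u) (fun x => c x.1) hu
  have hCne : C.Nonempty := by
    obtain ⟨i, hi, -⟩ := hdom (Classical.arbitrary T)
    exact ⟨i, hi⟩
  have hσne : σ.Nonempty := Finset.card_pos.1 (hcard ▸ Finset.card_pos.2 hCne)
  choose q hq hqmin using fun i => Finset.exists_min_image σ (fun x : T => x.1 i) hσne
  let l : ι → ℕ := fun i => (q i).1 i
  -- Otherwise some grid point exceeds `l i` in every coordinate of `C`, the surplus being put on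
  -- one `k ∈ C`; this contradicts dominance. Hence the minima on `C` use up all but fewer than
  -- `C.card` units of `m`, which keeps the points of `σ` close together.
  have hsum : m < ∑ i ∈ C, (l i + 1) := by
    by_contra! hle
    obtain ⟨k, hk⟩ := hCne
    let x : ι → ℕ := fun i => (if i ∈ C then l i + 1 else 0) +
      if i = k then m - ∑ i ∈ C, (l i + 1) else 0
    have hx : ∑ i, x i = m := by
      simp only [x, Finset.sum_add_distrib, Finset.sum_ite_mem, Finset.univ_inter,
        Finset.sum_ite_eq', Finset.mem_univ, if_true]
      rw [← Finset.sum_add_distrib]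
      omega
    obtain ⟨i, hi, h⟩ := hdom ⟨x, hmk x hx⟩
    have h1 := hule i _ _ (h (q i) (hq i))
    have h2 : l i + 1 ≤ x i := by simp [x, hi]
    have h3 : x i ≤ l i := h1
    omega
  rw [Finset.sum_add_distrib, Finset.sum_const, smul_eq_mul, mul_one] at hsum
  have hCcard : C.card ≤ Fintype.card ι := Finset.card_le_univ C
  have hout : ∀ y ∈ σ, ∀ j ∉ C, y.1 j ≤ Fintype.card ι := fun y hy j hj => by
    have h1 : ∑ i ∈ insert j C, y.1 i ≤ m :=
      (Finset.sum_le_sum_of_subset (Finset.subset_univ _)).trans (hT y).le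
    rw [Finset.sum_insert hj] at h1
    have h2 : ∑ i ∈ C, l i ≤ ∑ i ∈ C, y.1 i := Finset.sum_le_sum fun i _ => hqmin i y hy
    omega
  have hin : ∀ y ∈ σ, ∀ j ∈ C, l j ≤ y.1 j ∧ y.1 j ≤ l j + Fintype.card ι := fun y hy j hj => by
    have h1 : ∑ i ∈ C, y.1 i ≤ m :=
      (Finset.sum_le_sum_of_subset (Finset.subset_univ _)).trans (hT y).le
    have h2 : ∑ i ∈ C.erase j, l i ≤ ∑ i ∈ C.erase j, y.1 i :=
      Finset.sum_le_sum fun i _ => hqmin i y hy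
    rw [← Finset.add_sum_erase _ _ hj] at h1 hsum
    exact ⟨hqmin j y hy, by omega⟩
  have hclose : ∀ y ∈ σ, ∀ z ∈ σ, ∀ j, y.1 j ≤ z.1 j + Fintype.card ι := fun y hy z hz j => by
    by_cases hj : j ∈ C
    · have := hin y hy j hj
      have := hin z hz j hj
      omega
    · exact (hout y hy j hj).trans (Nat.le_add_left _ _)
  obtain ⟨z, hz⟩ := hσne
  refine ⟨z.1, hT z, fun i => ?_⟩
  by_cases hi : i ∈ C
  · right
    rw [← himg] at hi
    obtain ⟨y, hy, rfl⟩ := Finset.mem_image.1 hi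
    exact ⟨y.1, hT y, fun j => ⟨hclose y hy z hz j, hclose z hz y hy j⟩, rfl⟩
  · exact Or.inl (hout z hz i hi)

/-- A grid point is colored by a coordinate that `f` does not decrease, which exists because both
points have coordinate sum 1. Where a color is not attained near `z`, the coordinate of `z` is
itself within the error and `y = z` serves. -/
theorem exists_approx_fixedPoint [Nonempty ι] {f : (ι → ℝ) → ι → ℝ}
    (hf : Set.MapsTo f (stdSimplex ℝ ι) (stdSimplex ℝ ι)) (m : ℕ) :
    ∃ z ∈ stdSimplex ℝ ι, ∀ i, ∃ y ∈ stdSimplex ℝ ι,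
      (∀ j, |y j - z j| ≤ (Fintype.card ι : ℝ) / (m + 1)) ∧
      y i ≤ f y i + (Fintype.card ι : ℝ) / (m + 1) := by
  have hm : (0 : ℝ) < (m : ℝ) + 1 := by positivity
  let g : (ι → ℕ) → ι → ℝ := fun x i => (x i : ℝ) / (m + 1)
  have hg : ∀ x : ι → ℕ, ∑ i, x i = m + 1 → g x ∈ stdSimplex ℝ ι := fun x hx => by
    refine ⟨fun i => by positivity, ?_⟩
    rw [← Finset.sum_div, ← Nat.cast_sum, hx]
    push_cast
    exact div_self hm.ne'
  have hcol : ∀ x : ι → ℕ, ∃ i, ∑ i, x i = m + 1 → g x i ≤ f (g x) i := fun x => by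
    by_cases hx : ∑ i, x i = m + 1
    · by_contra! h
      have h1 : ∑ i, f (g x) i < ∑ i, g x i :=
        Finset.sum_lt_sum_of_nonempty Finset.univ_nonempty fun i _ => (h i).2
      rw [(hg x hx).2, (hf (hg x hx)).2] at h1
      exact lt_irrefl _ h1
    · exact ⟨Classical.arbitrary ι, fun h => absurd h hx⟩
  choose c hc using hcol
  obtain ⟨z, hz, h⟩ := exists_grid_point (m + 1) c
  refine ⟨g z, hg z hz, fun i => ?_⟩
  rcases h i with hi | ⟨y, hy, hyz, rfl⟩
  · refine ⟨g z, hg z hz, fun j => by simpa using by positivity, ?_⟩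
    have h1 := (hf (hg z hz)).1 i
    have h2 : g z i ≤ (Fintype.card ι : ℝ) / (m + 1) :=
      div_le_div_of_nonneg_right (by exact_mod_cast hi) hm.le
    linarith
  · refine ⟨g y, hg y hy, fun j => ?_, ?_⟩
    · have h1 : (y j : ℝ) ≤ z j + Fintype.card ι := by exact_mod_cast (hyz j).1
      have h2 : (z j : ℝ) ≤ y j + Fintype.card ι := by exact_mod_cast (hyz j).2
      simp only [g]
      rw [← sub_div, abs_div, abs_of_pos hm]
      refine div_le_div_of_nonneg_right ?_ hm.le
      rw [abs_le]
      constructor <;> linarith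
    · have := hc y hy
      have : (0 : ℝ) ≤ (Fintype.card ι : ℝ) / (m + 1) := by positivity
      linarith

/-- **Brouwer's fixed point theorem** on the standard simplex. -/
theorem exists_fixedPoint_stdSimplex [Nonempty ι] {f : (ι → ℝ) → ι → ℝ}
    (hcont : ContinuousOn f (stdSimplex ℝ ι))
    (hf : Set.MapsTo f (stdSimplex ℝ ι) (stdSimplex ℝ ι)) :
    ∃ x ∈ stdSimplex ℝ ι, f x = x := by
  choose z hz y hy hyz hyf using exists_approx_fixedPoint hf
  obtain ⟨x, hx, φ, hφ, hlim⟩ := (isCompact_stdSimplex ℝ ι).tendsto_subseq hz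
  have hε : Tendsto (fun n => (Fintype.card ι : ℝ) / ((φ n : ℕ) + 1)) atTop (𝓝 0) :=
    (tendsto_const_nhds.div_atTop
      (tendsto_atTop_add_const_right _ _ tendsto_natCast_atTop_atTop)).comp hφ.tendsto_atTop
  -- The witnesses `y` depend on `i` but all converge to `x`. Equality of the coordinate sums then
  -- turns these inequalities into equalities.
  have hle : ∀ i, x i ≤ f x i := fun i => by
    have hylim : Tendsto (fun n => y (φ n) i) atTop (𝓝 x) := by
      rw [tendsto_pi_nhds]
      intro j
      have h1 : Tendsto (fun n => y (φ n) i j - z (φ n) j) atTop (𝓝 0) :=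
        squeeze_zero_norm (fun n => hyz (φ n) i j) hε
      simpa using h1.add (tendsto_pi_nhds.1 hlim j)
    have hflim : Tendsto (fun n => f (y (φ n) i)) atTop (𝓝 (f x)) :=
      (hcont x hx).tendsto.comp (tendsto_nhdsWithin_iff.2
        ⟨hylim, Eventually.of_forall fun n => hy _ _⟩)
    have h2 := (tendsto_pi_nhds.1 hflim i).add hε
    rw [add_zero] at h2
    exact le_of_tendsto_of_tendsto' (tendsto_pi_nhds.1 hylim i) h2 fun n => hyf (φ n) i
  refine ⟨x, hx, funext fun i => ?_⟩
  have hsum : ∑ i, x i = ∑ i, f x i := by rw [hx.2, (hf hx).2]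
  exact ((Finset.sum_eq_sum_iff_of_le fun i _ => hle i).1 hsum i (Finset.mem_univ i)).symm

/-- **Brouwer's fixed point theorem** on a box. -/
theorem exists_fixedPoint_Icc {a b : ι → ℝ} (hab : a ≤ b) {f : (ι → ℝ) → ι → ℝ}
    (hcont : ContinuousOn f (Set.Icc a b)) (hf : Set.MapsTo f (Set.Icc a b) (Set.Icc a b)) :
    ∃ x ∈ Set.Icc a b, f x = x := by
  -- The box is a retract of a simplex: dividing by `K` keeps the coordinate sum at most 1, and
  -- `none` takes the slack. The `min` in `r` brings all other points of the simplex into the box.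
  let K : ℝ := 1 + ∑ i, (b i - a i)
  have hK : 0 < K := add_pos_of_pos_of_nonneg one_pos
    (Finset.sum_nonneg fun i _ => sub_nonneg.2 (hab i))
  let r : (Option ι → ℝ) → ι → ℝ := fun y i => min (b i) (a i + K * y (some i))
  let s : (ι → ℝ) → Option ι → ℝ := fun x o =>
    o.elim (1 - ∑ i, (x i - a i) / K) fun i => (x i - a i) / K
  have hr : Set.MapsTo r (stdSimplex ℝ (Option ι)) (Set.Icc a b) := fun y hy =>
    ⟨fun i => le_min (hab i) (le_add_of_nonneg_right (mul_nonneg hK.le (hy.1 _))),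
      fun i => min_le_left _ _⟩
  have hs : Set.MapsTo s (Set.Icc a b) (stdSimplex ℝ (Option ι)) := fun x hx => by
    refine ⟨fun o => ?_, ?_⟩
    · cases o with
      | none =>
        have h1 : ∑ i, (x i - a i) ≤ ∑ i, (b i - a i) :=
          Finset.sum_le_sum fun i _ => sub_le_sub_right (hx.2 i) _
        have h2 : (∑ i, (x i - a i)) / K ≤ 1 := by
          rw [div_le_one hK]
          simp only [K]
          linarith
        simp only [s, Option.elim]
        rw [← Finset.sum_div]
        linarith
      | some i => exact div_nonneg (sub_nonneg.2 (hx.1 i)) hK.le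
    · rw [Fintype.sum_option]
      simp [s]
  have hrs : ∀ x ∈ Set.Icc a b, r (s x) = x := fun x hx => funext fun i => by
    simp only [r, s, Option.elim]
    rw [mul_div_cancel₀ _ hK.ne', add_sub_cancel, min_eq_right (hx.2 i)]
  have hrc : Continuous r := by fun_prop
  have hsc : Continuous s := continuous_pi fun o => by
    cases o <;> simp only [s, Option.elim] <;> fun_prop
  obtain ⟨y, hy, hfix⟩ := exists_fixedPoint_stdSimplex (f := s ∘ f ∘ r)
    (hsc.comp_continuousOn (hcont.comp hrc.continuousOn hr)) (hs.comp (hf.comp hr))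
  refine ⟨r y, hr hy, ?_⟩
  have h := congrArg r hfix
  simp only [Function.comp] at h
  rwa [hrs _ (hf (hr hy))] at h

end Brouwer

noncomputable section

/-! ### The logit model -/

namespace CreditScheme

open Filter Topology

variable (M : CreditScheme)

theorem choiceProb_nonneg (C : M.Profile) (i : Fin M.N) (k : M.Slot) : 0 ≤ M.choiceProb C i k :=
  div_nonneg (Real.exp_pos _).le (Finset.sum_nonneg fun _ _ => (Real.exp_pos _).le)

theorem sum_exp_pos (C : M.Profile) (i : Fin M.N) : 0 < ∑ s, Real.exp (M.μ * C i s) :=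
  Finset.sum_pos (fun _ _ => Real.exp_pos _) Finset.univ_nonempty

theorem sum_choiceProb (C : M.Profile) (i : Fin M.N) : ∑ k, M.choiceProb C i k = 1 := by
  simp only [choiceProb]
  rw [← Finset.sum_div, div_self (M.sum_exp_pos C i).ne']

theorem choiceProb_le_exp_sub (C : M.Profile) (i : Fin M.N) (k l : M.Slot) :
    M.choiceProb C i k ≤ Real.exp (M.μ * (C i k - C i l)) := by
  rw [mul_sub, Real.exp_sub]
  exact div_le_div_of_nonneg_left (Real.exp_pos _).le (Real.exp_pos _)
    (Finset.single_le_sum (f := fun s => Real.exp (M.μ * C i s))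
      (fun _ _ => (Real.exp_pos _).le) (Finset.mem_univ l))

theorem patternProb_nonneg (C : M.Profile) (σ : M.Pattern) : 0 ≤ M.patternProb C σ :=
  Finset.prod_nonneg fun i _ => M.choiceProb_nonneg C i _

theorem sum_patternProb (C : M.Profile) : ∑ σ, M.patternProb C σ = 1 := by
  simp only [patternProb]
  rw [← Fintype.prod_sum]
  exact Finset.prod_eq_one fun i _ => M.sum_choiceProb C i

/-- The choice of traveler `i` in a random pattern is distributed according to her own logit
probabilities. -/
theorem sum_patternProb_mul_apply (C : M.Profile) (i : Fin M.N) (h : M.Slot → ℝ) :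
    ∑ σ, M.patternProb C σ * h (σ i) = ∑ k, M.choiceProb C i k * h k := by
  have hterm : ∀ σ : M.Pattern, M.patternProb C σ * h (σ i) =
      -- With `h` absorbed as a factor at `i`, the sum over patterns becomes a product of sums, all
      -- equal to 1 except the one at `i`.
      ∏ j, M.choiceProb C j (σ j) * (if j = i then h (σ j) else 1) := fun σ => by
    rw [Finset.prod_mul_distrib, Finset.prod_ite_eq' Finset.univ i fun j => h (σ j),
      if_pos (Finset.mem_univ i)]
    rfl
  rw [Finset.sum_congr rfl fun σ _ => hterm σ,
    ← Fintype.prod_sum fun j k => M.choiceProb C j k * (if j = i then h k else 1)]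
  rw [Finset.prod_eq_single i]
  · simp
  · intro j _ hj
    simp [hj, M.sum_choiceProb]
  · simp

theorem consumption_eq (C : M.Profile) :
    M.consumption C = ∑ i, ∑ k, M.choiceProb C i k * M.charge i k := by
  simp only [consumption, Finset.mul_sum]
  rw [Finset.sum_comm]
  exact Finset.sum_congr rfl fun i _ => M.sum_patternProb_mul_apply C i (M.charge i)

theorem continuous_choiceProb (i : Fin M.N) (k : M.Slot) :
    Continuous fun C : M.Profile => M.choiceProb C i k :=
  Continuous.div (by fun_prop) (by fun_prop) fun C => (M.sum_exp_pos C i).ne'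

theorem continuous_patternProb (σ : M.Pattern) :
    Continuous fun C : M.Profile => M.patternProb C σ :=
  continuous_finsetProd _ fun i _ => M.continuous_choiceProb i _

/-- The time cost of a pattern does not depend on `C`, so no regularity of the traffic model enters.
-/
theorem continuous_meanTimeCost (i : Fin M.N) (k : M.Slot) :
    Continuous fun C : M.Profile => M.meanTimeCost C i k :=
  continuous_finsetSum _ fun σ _ => (M.continuous_patternProb σ).mul continuous_const

theorem continuous_excess : Continuous M.excess :=
  (continuous_finsetSum _ fun σ _ => (M.continuous_patternProb σ).mul continuous_const).sub
    continuous_const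

/-- A bound of the time costs over all departure patterns. -/
def timeCostBound : ℝ := ∑ σ : M.Pattern, ∑ i, ∑ k, |M.timeCost σ i k|

theorem timeCostBound_nonneg : 0 ≤ M.timeCostBound :=
  Finset.sum_nonneg fun _ _ => Finset.sum_nonneg fun _ _ => Finset.sum_nonneg fun _ _ =>
    abs_nonneg _

theorem abs_timeCost_le (σ : M.Pattern) (i : Fin M.N) (k : M.Slot) :
    |M.timeCost σ i k| ≤ M.timeCostBound := by
  have h1 : |M.timeCost σ i k| ≤ ∑ k, |M.timeCost σ i k| :=
    Finset.single_le_sum (f := fun k => |M.timeCost σ i k|) (fun _ _ => abs_nonneg _)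
      (Finset.mem_univ k)
  have h2 : ∑ k, |M.timeCost σ i k| ≤ ∑ i, ∑ k, |M.timeCost σ i k| :=
    Finset.single_le_sum (f := fun i => ∑ k, |M.timeCost σ i k|)
      (fun _ _ => Finset.sum_nonneg fun _ _ => abs_nonneg _) (Finset.mem_univ i)
  have h3 : ∑ i, ∑ k, |M.timeCost σ i k| ≤ M.timeCostBound :=
    Finset.single_le_sum (f := fun σ => ∑ i, ∑ k, |M.timeCost σ i k|)
      (fun _ _ => Finset.sum_nonneg fun _ _ => Finset.sum_nonneg fun _ _ => abs_nonneg _)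
      (Finset.mem_univ σ)
  exact h1.trans (h2.trans h3)

theorem abs_meanTimeCost_le (C : M.Profile) (i : Fin M.N) (k : M.Slot) :
    |M.meanTimeCost C i k| ≤ M.timeCostBound := by
  calc |M.meanTimeCost C i k| ≤ ∑ σ, |M.patternProb C σ * M.timeCost σ i k| :=
        Finset.abs_sum_le_sum_abs _ _
    _ ≤ ∑ σ, M.patternProb C σ * M.timeCostBound := Finset.sum_le_sum fun σ _ => by
        rw [abs_mul, abs_of_nonneg (M.patternProb_nonneg C σ)]
        exact mul_le_mul_of_nonneg_left (M.abs_timeCost_le σ i k) (M.patternProb_nonneg C σ)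
    _ = M.timeCostBound := by rw [← Finset.sum_mul, M.sum_patternProb, one_mul]

/-! ### Credit consumption at high prices -/

/-- Least charge in the time window of traveler `i`. -/
def minCharge (i : Fin M.N) : ℝ := Finset.univ.inf' Finset.univ_nonempty (M.charge i)

theorem minCharge_le (i : Fin M.N) (k : M.Slot) : M.minCharge i ≤ M.charge i k :=
  Finset.inf'_le _ (Finset.mem_univ k)

theorem sum_minCharge_le_consumption (C : M.Profile) :
    ∑ i, M.minCharge i ≤ M.consumption C := by
  rw [consumption_eq]
  refine Finset.sum_le_sum fun i _ => ?_
  calc M.minCharge i = ∑ k, M.choiceProb C i k * M.minCharge i := by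
        rw [← Finset.sum_mul, M.sum_choiceProb, one_mul]
    _ ≤ _ := Finset.sum_le_sum fun k _ =>
        mul_le_mul_of_nonneg_left (M.minCharge_le i k) (M.choiceProb_nonneg C i k)

/-- At high prices the consumption is close to its least value, uniformly for bounded time costs. -/
theorem consumption_genValue_le {B : ℝ} {x : M.Profile} (hx : ∀ i k, |x i k| ≤ B) {p : ℝ}
    (hp : 0 < p) :
    M.consumption (M.genValue x p) ≤ ∑ i, M.minCharge i +
      (∑ i, ∑ _k : M.Slot, Real.exp (M.μ * (2 * M.θ i * B)) / M.μ) / p := by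
  have hμ := M.μ_pos
  rw [consumption_eq, Finset.sum_div, ← Finset.sum_add_distrib]
  refine Finset.sum_le_sum fun i _ => ?_
  obtain ⟨l, -, hl⟩ := Finset.exists_mem_eq_inf' (Finset.univ_nonempty (α := M.Slot)) (M.charge i)
  have hl : M.minCharge i = M.charge i l := hl
  set C := M.genValue x p
  have hterm : ∀ k, M.choiceProb C i k * M.charge i k ≤ M.choiceProb C i k * M.minCharge i +
      Real.exp (M.μ * (2 * M.θ i * B)) / M.μ / p := fun k => by
    set d := M.charge i k - M.minCharge i with hd
    have hd0 : 0 ≤ d := sub_nonneg.2 (M.minCharge_le i k)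
    -- Against the cheapest slot `l`, time costs can favor `k` by at most `2 * θ i * B`, while the
    -- extra charge `d` costs `p * d`.
    have hC : C i k - C i l ≤ 2 * M.θ i * B - p * d := by
      have h1 := abs_le.1 (hx i k)
      have h2 := abs_le.1 (hx i l)
      have h3 : M.θ i * (x i l - x i k) ≤ M.θ i * (2 * B) :=
        mul_le_mul_of_nonneg_left (by linarith) (M.θ_pos i).le
      simp only [C, genValue, hd, hl]
      nlinarith
    have hprob : M.choiceProb C i k ≤
        Real.exp (M.μ * (2 * M.θ i * B)) * Real.exp (-(M.μ * p * d)) := by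
      refine (M.choiceProb_le_exp_sub C i k l).trans ?_
      rw [← Real.exp_add]
      refine Real.exp_le_exp.2 ((mul_le_mul_of_nonneg_left hC hμ.le).trans_eq ?_)
      ring
    -- This is `s * exp (-s) ≤ 1` with `s = μ * p * d`; it bounds the expected extra charge
    -- uniformly in `d`.
    have hexp : Real.exp (-(M.μ * p * d)) * d ≤ 1 / (M.μ * p) := by
      rw [Real.exp_neg, le_div_iff₀ (mul_pos hμ hp), inv_mul_eq_div, div_mul_eq_mul_div,
        div_le_one (Real.exp_pos _)]
      have := Real.add_one_le_exp (M.μ * p * d)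
      linarith
    have h1 : M.choiceProb C i k * d ≤ Real.exp (M.μ * (2 * M.θ i * B)) / M.μ / p := by
      calc M.choiceProb C i k * d
          ≤ Real.exp (M.μ * (2 * M.θ i * B)) * Real.exp (-(M.μ * p * d)) * d :=
            mul_le_mul_of_nonneg_right hprob hd0
        _ = Real.exp (M.μ * (2 * M.θ i * B)) * (Real.exp (-(M.μ * p * d)) * d) := mul_assoc _ _ _
        _ ≤ Real.exp (M.μ * (2 * M.θ i * B)) * (1 / (M.μ * p)) :=
            mul_le_mul_of_nonneg_left hexp (Real.exp_pos _).le
        _ = _ := by rw [mul_one_div, div_div]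
    have h2 : M.choiceProb C i k * M.charge i k =
        M.choiceProb C i k * M.minCharge i + M.choiceProb C i k * d := by rw [hd]; ring
    linarith
  refine (Finset.sum_le_sum fun k _ => hterm k).trans_eq ?_
  rw [Finset.sum_add_distrib, ← Finset.sum_mul, M.sum_choiceProb, one_mul, Finset.sum_div]

/-! ### Existence of an equilibrium -/

theorem continuous_genValue : Continuous fun X : M.Profile × ℝ => M.genValue X.1 X.2 :=
  continuous_pi fun i => continuous_pi fun k => by
    simp only [genValue]
    fun_prop

/-- Time costs and a price in `[0, P]` that are reproduced by the expected time costs and by the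
price adjustment truncated to `[0, P]`. -/
theorem exists_fixedPoint_truncated {P : ℝ} (hP : 0 ≤ P) :
    ∃ (y : M.Profile) (p : ℝ), M.meanTimeCost (M.genValue y p) = y ∧
      max 0 (min P (p + M.excess (M.genValue y p))) = p := by
  let B := M.timeCostBound
  let dec : (Option (Fin M.N × M.Slot) → ℝ) → M.Profile × ℝ :=
    fun z => (fun i k => z (some (i, k)), z none)
  let val : (Option (Fin M.N × M.Slot) → ℝ) → M.Profile :=
    fun z => M.genValue (dec z).1 (dec z).2
  -- The coordinate `none` carries the price. With time costs rather than values as unknowns, their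
  -- bound `B` does not depend on `P`.
  let f : (Option (Fin M.N × M.Slot) → ℝ) → Option (Fin M.N × M.Slot) → ℝ := fun z o =>
    o.elim (max 0 (min P (z none + M.excess (val z)))) fun ik =>
      M.meanTimeCost (val z) ik.1 ik.2
  have hdec : Continuous dec := by fun_prop
  have hval : Continuous val := M.continuous_genValue.comp hdec
  have hf : Continuous f := continuous_pi fun o => by
    cases o with
    | none =>
      exact continuous_const.max (continuous_const.min
        ((continuous_apply _).add (M.continuous_excess.comp hval)))
    | some ik => exact (M.continuous_meanTimeCost _ _).comp hval
  have hB : 0 ≤ B := M.timeCostBound_nonneg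
  obtain ⟨z, -, hz⟩ := exists_fixedPoint_Icc (a := fun o => o.elim 0 fun _ => -B)
    (b := fun o => o.elim P fun _ => B) (f := f)
    (fun o => by
      cases o with
      | none => exact hP
      | some _ => exact neg_le_self hB)
    hf.continuousOn
    (fun z _ => ⟨fun o => by
      cases o with
      | none => exact le_max_left _ _
      | some ik => exact (abs_le.1 (M.abs_meanTimeCost_le (val z) ik.1 ik.2)).1,
    fun o => by
      cases o with
      | none => exact max_le hP (min_le_left _ _)
      | some ik => exact (abs_le.1 (M.abs_meanTimeCost_le (val z) ik.1 ik.2)).2⟩)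
  exact ⟨(dec z).1, (dec z).2, funext fun i => funext fun k => congrFun hz (some (i, k)),
    congrFun hz none⟩

/-- If credits are less scarce than the least consumption, some price clears the market. -/
theorem exists_market_clearing (h : ∑ i, M.minCharge i < M.I * (M.N : ℝ)) :
    ∃ (C : M.Profile) (p : ℝ), 0 ≤ p ∧ M.experienced C p = C ∧ M.excess C ≤ 0 ∧
      (0 < p → M.excess C = 0) := by
  set A := ∑ i, ∑ _k : M.Slot, Real.exp (M.μ * (2 * M.θ i * M.timeCostBound)) / M.μ with hA
  have hA0 : 0 ≤ A := Finset.sum_nonneg fun _ _ => Finset.sum_nonneg fun _ _ =>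
    div_nonneg (Real.exp_pos _).le M.μ_pos.le
  have hgap := sub_pos.2 h
  -- At this price the surplus `A / P` over the minimal consumption is less than the gap to the
  -- endowment, so excess is negative and `p = P` would be pushed down.
  set P := A / (M.I * (M.N : ℝ) - ∑ i, M.minCharge i) + 1 with hPdef
  have hP : 0 < P := by positivity
  obtain ⟨y, p, hy, hp⟩ := M.exists_fixedPoint_truncated hP.le
  have hy_le : ∀ i k, |y i k| ≤ M.timeCostBound := fun i k => by
    rw [← hy]
    exact M.abs_meanTimeCost_le _ i k
  have hp0 : 0 ≤ p := hp ▸ le_max_left _ _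
  have hpP : p ≤ P := hp ▸ max_le hP.le (min_le_left _ _)
  have hlt : p < P := by
    refine lt_of_le_of_ne hpP fun hpP => ?_
    have h1 := M.consumption_genValue_le hy_le (hpP ▸ hP : 0 < p)
    have h2 : A / p < M.I * (M.N : ℝ) - ∑ i, M.minCharge i := by
      rw [hpP, div_lt_iff₀ hP, hPdef, mul_add, mul_div_cancel₀ _ hgap.ne']
      linarith
    have h3 : M.excess (M.genValue y p) < 0 := by
      simp only [excess]
      linarith
    rcases le_max_iff.1 hp.ge with h4 | h4
    · linarith
    · have := h4.trans (min_le_right _ _)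
      linarith
  have hexcess : M.excess (M.genValue y p) ≤ 0 := by
    by_contra! h1
    have h2 : p < min P (p + M.excess (M.genValue y p)) := lt_min hlt (by linarith)
    have h3 : min P (p + M.excess (M.genValue y p)) ≤ p := (le_max_right _ _).trans hp.le
    linarith
  refine ⟨M.genValue y p, p, hp0, ?_, hexcess, fun hppos => le_antisymm hexcess ?_⟩
  · rw [experienced, hy]
  -- For `p > 0` the lower truncation is inactive, so `p ≤ p + Z`.
  · rcases le_max_iff.1 hp.ge with h4 | h4
    · linarith
    · have := h4.trans (min_le_right _ _)
      linarith

end CreditScheme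

end

/-! ### From market clearing to a fixed point of the dynamics. -/

theorem theorem1 (M : CreditScheme) (Q : ℝ → ℝ → ℝ) (hQ : CreditScheme.IsPriceRule Q)
    (hgrid : M.NoGridlock)
    (x : M.Profile) (Imin : ℝ)
    (hmin : Filter.Tendsto (fun p : ℝ => M.consumption (M.genValue x p)) Filter.atTop
      (nhds (Imin * (M.N : ℝ))))
    (hI : Imin * (M.N : ℝ) < M.I * (M.N : ℝ)) :
    ∃ (C : M.Profile) (p : ℝ), M.IsEquilibrium Q C p ∧
      C = M.experienced C p ∧ Q p (M.excess C) = 0 := by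
  -- Only this inequality is needed: the lower bound on consumption holds at every price and passes
  -- to the limit.
  have hleast : ∑ i, M.minCharge i ≤ Imin * (M.N : ℝ) :=
    ge_of_tendsto' hmin fun p => M.sum_minCharge_le_consumption _
  obtain ⟨C, p, hp, hC, hle, heq⟩ := M.exists_market_clearing (hleast.trans_lt hI)
  have hQ0 : Q p (M.excess C) = 0 := by
    rcases hp.eq_or_lt with rfl | hpos
    · exact hQ.zero_apply _ hle
    · rw [heq hpos]
      exact hQ.apply_zero p hp
  refine ⟨C, p, ⟨hp, Prod.ext (funext fun i => funext fun k => ?_) ?_⟩, hC.symm, hQ0⟩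
  · simp only [CreditScheme.dayStep, hC]
    ring
  · simp only [CreditScheme.dayStep, hQ0, add_zero]
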